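/- Let $n$ be a positive integer and let $\mathcal{C}$ be an $n$-abelian category, that is, an additive and idempotent complete category such that: (A1) every morphism $f\colon X\to Y$ has an $n$-kernel, i.e. a sequence $X_n\to\cdots\to X_1\to X$ such that $0\to\mathcal{C}(W,X_n)\to\cdots\to\mathcal{C}(W,X_1)\to\mathcal{C}(W,X)\to\mathcal{C}(W,Y)$ is an exact sequence of abelian groups for every object $W$; (A1$^{\mathrm{op}}$) every morphism $f\colon X\to Y$ has an $n$-cokernel, i.e. a sequence $Y\to Y_1\to\cdots\to Y_n$ such that $0\to\mathcal{C}(Y_n,W)\to\cdots\to\mathcal{C}(Y_1,W)\to\mathcal{C}(Y,W)\to\mathcal{C}(X,W)$ is an exact sequence of abelian groups for every object $W$; (A2) for every monomorphism $f\colon X\to Y$ and every $n$-cokernel $Y\to Y_1\to\cdots\to Y_n$ of $f$, the sequence $X\to Y\to Y_1\to\cdots\to Y_{n-1}$ is an $n$-kernel of the morphism $Y_{n-1}\to Y_n$ (where $Y_0=Y$); (A2$^{\mathrm{op}}$) for every epimorphism $f\colon X\to Y$ and every $n$-kernel $X_n\to\cdots\to X_1\to X$ of $f$, the sequence $X_{n-1}\to\cdots\to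 X_1\to X\to Y$ is an $n$-cokernel of the morphism $X_n\to X_{n-1}$ (where $X_0=X$). Let $\operatorname{mod}\mathcal{C}$ be the category of finitely presented contravariant additive functors $F$ from $\mathcal{C}$ to abelian groups, i.e. those for which there is a (componentwise) exact sequence $\mathcal{C}(-,X)\xrightarrow{\mathcal{C}(-,f)}\mathcal{C}(-,Y)\to F\to 0$ with $f\colon X\to Y$ a morphism of $\mathcal{C}$; likewise $\operatorname{mod}\mathcal{C}^{\mathrm{op}}$ for covariant functors. Suppose that $\mathcal{C}$ is not von Neumann regular, i.e. not every morphism $f$ of $\mathcal{C}$ can be written as $f=jp$ with $p$ a split epimorphism and $j$ a split monomorphism. Then $\operatorname{mod}\mathcal{C}$ and $\operatorname{mod}\mathcal{C}^{\mathrm{op}}$ are abelian categories and $$\operatorname{gldim}(\operatorname{mod}\mathcal{C})=\operatorname{gldim}(\operatorname{mod}\mathcal{C}^{\mathrm{op}})=n+1.$$ -/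

import Mathlib

open CategoryTheory CategoryTheory.Limits Opposite

universe v u

namespace HigherAbelian

section Modules

variable (C : Type u) [Category.{v} C] [Preadditive C]

/-- A right `C`-module (a contravariant additive functor `F` from `C` to abelian groups) is
finitely presented if there is a morphism `f : X ⟶ Y` and an exact sequence
`C(-,X) ⟶ C(-,Y) ⟶ F ⟶ 0` whose first map is `C(-,f)`; exactness of sequences of modules is
exactness of their components at every object of `C`. -/
def IsFinitelyPresented : ObjectProperty (Cᵒᵖ ⥤ AddCommGrpCat.{v}) := fun F =>
  F.Additive ∧ ∃ (X Y : C) (f : X ⟶ Y) (p : preadditiveYoneda.obj Y ⟶ F), ∀ W : Cᵒᵖ,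
    Function.Exact ((preadditiveYoneda.map f).app W) (p.app W) ∧
      Function.Surjective (p.app W)

/-- The category `mod C` of finitely presented right `C`-modules, with all natural transformations
as morphisms. The category of finitely presented left `C`-modules is `FPMod Cᵒᵖ`. -/
abbrev FPMod := (IsFinitelyPresented C).FullSubcategory

end Modules

/-- The global dimension of an abelian category: the supremum of the projective dimensions of its
objects. (Zero objects have projective dimension `⊥`.) -/
noncomputable def globalDimension (A : Type u) [Category.{v} A] [Abelian A] : WithBot ℕ∞ :=
  ⨆ X : A, projectiveDimension X

section NAbelian

variable {C : Type u} [Category.{v} C] [Preadditive C]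

/-- The sequence `S : S₀ ⟶ S₁ ⟶ ⋯ ⟶ Sₙ ⟶ Sₙ₊₁` induces an exact sequence of abelian groups
`0 ⟶ C(W,S₀) ⟶ C(W,S₁) ⟶ ⋯ ⟶ C(W,Sₙ) ⟶ C(W,Sₙ₊₁)` for every object `W`. -/
def IsLeftExactSeq {n : ℕ} (S : ComposableArrows C (n + 1)) : Prop :=
  ∀ W : C,
    Function.Injective (fun g : W ⟶ S.obj' 0 => g ≫ S.map' 0 1) ∧
    ∀ (i : ℕ) (hi : i < n),
      Function.Exact (fun g : W ⟶ S.obj' i => g ≫ S.map' i (i + 1))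
        (fun g : W ⟶ S.obj' (i + 1) => g ≫ S.map' (i + 1) (i + 2))

/-- The sequence `S : S₀ ⟶ S₁ ⟶ ⋯ ⟶ Sₙ ⟶ Sₙ₊₁` induces an exact sequence of abelian groups
`0 ⟶ C(Sₙ₊₁,W) ⟶ C(Sₙ,W) ⟶ ⋯ ⟶ C(S₁,W) ⟶ C(S₀,W)` for every object `W`. -/
def IsRightExactSeq {n : ℕ} (S : ComposableArrows C (n + 1)) : Prop :=
  ∀ W : C,
    Function.Injective (fun g : S.obj' (n + 1) ⟶ W => S.map' n (n + 1) ≫ g) ∧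
    ∀ (i : ℕ) (hi : i < n),
      Function.Exact (fun g : S.obj' (i + 2) ⟶ W => S.map' (i + 1) (i + 2) ≫ g)
        (fun g : S.obj' (i + 1) ⟶ W => S.map' i (i + 1) ≫ g)

/-- `S : Xₙ ⟶ ⋯ ⟶ X₁ ⟶ X ⟶ Y` ends in the morphism `f : X ⟶ Y`, and the part of it that precedes
`f` is an `n`-kernel of `f`. -/
structure IsNKernel {n : ℕ} {X Y : C} (f : X ⟶ Y) (S : ComposableArrows C (n + 1)) : Prop where
  last_eq : Arrow.mk (S.map' n (n + 1)) = Arrow.mk f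
  exact : IsLeftExactSeq S

/-- `S : X ⟶ Y ⟶ Y₁ ⟶ ⋯ ⟶ Yₙ` begins with the morphism `f : X ⟶ Y`, and the part of it that follows
`f` is an `n`-cokernel of `f`. -/
structure IsNCokernel {n : ℕ} {X Y : C} (f : X ⟶ Y) (S : ComposableArrows C (n + 1)) : Prop where
  first_eq : Arrow.mk (S.map' 0 1) = Arrow.mk f
  exact : IsRightExactSeq S

variable (C) in
/-- The axioms of an `n`-abelian category (for `n ≥ 1`), for an additive and idempotent complete
category `C`. -/
structure IsNAbelian (n : ℕ) : Prop where
  /-- Every morphism has an `n`-kernel. -/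
  hasNKernels : ∀ {X Y : C} (f : X ⟶ Y), ∃ S : ComposableArrows C (n + 1), IsNKernel f S
  /-- Every morphism has an `n`-cokernel. -/
  hasNCokernels : ∀ {X Y : C} (f : X ⟶ Y), ∃ S : ComposableArrows C (n + 1), IsNCokernel f S
  /-- For every monomorphism `f : X ⟶ Y` and every `n`-cokernel `Y ⟶ Y₁ ⟶ ⋯ ⟶ Yₙ` of `f`, the
  sequence `X ⟶ Y ⟶ ⋯ ⟶ Yₙ₋₁` is an `n`-kernel of `Yₙ₋₁ ⟶ Yₙ`. -/
  isNKernel_of_mono : ∀ {X Y : C} (f : X ⟶ Y) [Mono f] (S : ComposableArrows C (n + 1)),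
    IsNCokernel f S → IsNKernel (S.map' n (n + 1)) S
  /-- For every epimorphism `f : X ⟶ Y` and every `n`-kernel `Xₙ ⟶ ⋯ ⟶ X₁ ⟶ X` of `f`, the
  sequence `Xₙ₋₁ ⟶ ⋯ ⟶ X ⟶ Y` is an `n`-cokernel of `Xₙ ⟶ Xₙ₋₁`. -/
  isNCokernel_of_epi : ∀ {X Y : C} (f : X ⟶ Y) [Epi f] (S : ComposableArrows C (n + 1)),
    IsNKernel f S → IsNCokernel (S.map' 0 1) S

end NAbelian

/-- Every morphism is a split epimorphism followed by a split monomorphism. -/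
def IsVonNeumannRegular (C : Type u) [Category.{v} C] : Prop :=
  ∀ {X Y : C} (f : X ⟶ Y), ∃ (Z : C) (p : X ⟶ Z) (j : Z ⟶ Y),
    IsSplitEpi p ∧ IsSplitMono j ∧ p ≫ j = f

end HigherAbelian

/-! Finitely presented modules are the cokernels of maps between representables, and representables
are projective. An `n`-kernel of `f` becomes a projective resolution of length `n + 1` of the
cokernel of `C(-,f)`, so projective dimensions are at most `n + 1`. Dimension shifting shows that
the bound is attained once some left exact sequence starts with a map that is not a split mono
(`IsLeftExactSeq.hasProjectiveDimensionLT`).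

Such a sequence exists by contraposition (`exists_not_isSplitMono`). By (A2op) the `n`-kernel of an
epi `f` is right exact; if its first map splits, quasi-inverses propagate along it to `f`, so `f`
splits. If all epis split, quasi-inverses propagate backwards along any `n`-cokernel, so every
morphism has one, and splitting idempotents gives von Neumann regularity. Left modules are right
modules over `Cᵒᵖ`; the sequence needed there is a reversed right exact one
(`exists_not_isSplitEpi`).

The category `mod C` is abelian because weak kernels make it closed under kernels, cokernels and
finite products among all functors. -/

namespace HigherAbelian

/-! ### Projective dimension of cokernels by dimension shifting -/

section ProjectiveDimension

variable {C : Type*} [Category* C] [Preadditive C] {A : Type*} [Category* A] [Abelian A]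

/-- A functor `Y : C ⥤ A` which identifies `C` with a full subcategory of projective objects of the
abelian category `A`, such that every object of `A` has a presentation by objects of `C`. -/
structure IsProjectivePresentation (Y : C ⥤ A) : Prop where
  full : Y.Full
  faithful : Y.Faithful
  map_zero (X X' : C) : Y.map (0 : X ⟶ X') = 0
  projective (X : C) : Projective (Y.obj X)
  presentation (F : A) : ∃ (X X' : C) (f : X ⟶ X') (p : Y.obj X' ⟶ F), Epi p ∧
    Y.map f ≫ p = 0 ∧ ∀ (W : C) (w : W ⟶ X'), Y.map w ≫ p = 0 → ∃ v, v ≫ f = w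

namespace IsProjectivePresentation

variable {Y : C ⥤ A} (hY : IsProjectivePresentation Y)
include hY

/-- Every object of `A` is covered by some `Y.obj W`, so exactness need only be tested on maps out
of these, which come from `C` by fullness. -/
lemma exact {X X' : C} {F : A} (f : X ⟶ X') (p : Y.obj X' ⟶ F) (hp : Y.map f ≫ p = 0)
    (h : ∀ (W : C) (w : W ⟶ X'), Y.map w ≫ p = 0 → ∃ v, v ≫ f = w) :
    (ShortComplex.mk _ _ hp).Exact := by
  have := hY.full
  rw [ShortComplex.exact_iff_exact_up_to_refinements]
  intro T x hx
  obtain ⟨_, W, _, q, hq, -⟩ := hY.presentation T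
  obtain ⟨w, hw⟩ := Y.map_surjective (q ≫ x)
  obtain ⟨v, hv⟩ := h W w (by dsimp at hx; simp [hw, hx])
  exact ⟨Y.obj W, q, hq, Y.map v, by simp [← hw, ← hv]⟩

lemma exact_map {X X' X'' : C} (f : X ⟶ X') (g : X' ⟶ X'') (hfg : f ≫ g = 0)
    (h : ∀ (W : C) (w : W ⟶ X'), w ≫ g = 0 → ∃ v, v ≫ f = w) :
    (ShortComplex.mk (Y.map f) (Y.map g)
      (by rw [← Y.map_comp, hfg, hY.map_zero])).Exact := by
  have := hY.faithful
  refine hY.exact _ _ _ fun W w hw ↦ h W w (Y.map_injective ?_)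
  rw [Y.map_comp, hw, hY.map_zero]

lemma mono_map {X X' : C} (f : X ⟶ X') (h : ∀ (W : C) (w : W ⟶ X), w ≫ f = 0 → w = 0) :
    Mono (Y.map f) := by
  have := hY.full
  have := hY.faithful
  refine Preadditive.mono_of_cancel_zero _ fun {T} x hx ↦ ?_
  obtain ⟨_, W, _, q, hq, -⟩ := hY.presentation T
  obtain ⟨w, hw⟩ := Y.map_surjective (q ≫ x)
  have hw' : w = 0 := h W w (Y.map_injective (by rw [Y.map_comp, hw, hY.map_zero]; simp [hx]))
  rw [← cancel_epi q, ← hw, hw', hY.map_zero, comp_zero]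

lemma exists_iso_cokernel (F : A) :
    ∃ (X X' : C) (f : X ⟶ X'), Nonempty (cokernel (Y.map f) ≅ F) := by
  obtain ⟨X, X', f, p, hp, hfp, h⟩ := hY.presentation F
  refine ⟨X, X', f, ⟨(cokernelIsCokernel _).coconePointUniqueUpToIso
    (hY.exact f p hfp h).gIsCokernel⟩⟩

end IsProjectivePresentation

lemma shortExact_cokernel_desc {P Q R : A} (f : P ⟶ Q) (g : Q ⟶ R) (w : f ≫ g = 0)
    (h : (ShortComplex.mk f g w).Exact) :
    (ShortComplex.mk (cokernel.desc f g w) (cokernel.π g)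
      (by rw [← cancel_epi (cokernel.π f)]; simp)).ShortExact where
  exact := by
    let φ : ShortComplex.mk g (cokernel.π g) (cokernel.condition g) ⟶
        ShortComplex.mk (cokernel.desc f g w) (cokernel.π g)
          (by rw [← cancel_epi (cokernel.π f)]; simp) :=
      { τ₁ := cokernel.π f, τ₂ := 𝟙 _, τ₃ := 𝟙 _ }
    have : Epi φ.τ₁ := inferInstanceAs (Epi (cokernel.π f))
    have : IsIso φ.τ₂ := inferInstanceAs (IsIso (𝟙 _))
    have : Mono φ.τ₃ := inferInstanceAs (Mono (𝟙 _))
    exact (ShortComplex.exact_iff_of_epi_of_isIso_of_mono φ).1 (ShortComplex.exact_cokernel g)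
  mono_f := (ShortComplex.exact_iff_mono_cokernel_desc _).1 h
  epi_g := inferInstanceAs (Epi (cokernel.π g))

lemma IsLeftExactSeq.comp_eq_zero {n : ℕ} {S : ComposableArrows C (n + 1)}
    (hS : IsLeftExactSeq S) (i : ℕ) (hi : i < n) :
    S.map' i (i + 1) ≫ S.map' (i + 1) (i + 2) = 0 := by
  have := ((hS (S.obj' i)).2 i hi).apply_apply_eq_zero (𝟙 _)
  simpa only [Category.id_comp] using this

variable {Y : C ⥤ A} (hY : IsProjectivePresentation Y) {n : ℕ} {S : ComposableArrows C (n + 1)}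
  (hS : IsLeftExactSeq S)
include hY hS

/-- The `i`-th cokernel is the first syzygy of the next one, so each step shifts the dimension by
one. At `i = 0` the resolution has length one, and projectivity of the cokernel splits it. -/
lemma IsLeftExactSeq.hasProjectiveDimensionLT (i : ℕ) (hi : i ≤ n) :
    HasProjectiveDimensionLT (cokernel (Y.map (S.map' i (i + 1)))) (i + 2) ∧
      (HasProjectiveDimensionLT (cokernel (Y.map (S.map' i (i + 1)))) (i + 1) →
        IsSplitMono (S.map' 0 1)) := by
  have hproj := hY.projective
  induction i with
  | zero =>
    have := hY.mono_map (S.map' 0 1) fun W w hw ↦ (hS W).1 (hw.trans zero_comp.symm)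
    have hse : (ShortComplex.mk _ _ (cokernel.condition (Y.map (S.map' 0 1)))).ShortExact :=
      { exact := ShortComplex.exact_cokernel _
        mono_f := this
        epi_g := inferInstanceAs (Epi (cokernel.π _)) }
    refine ⟨(hse.hasProjectiveDimensionLT_X₃_iff 0 (hproj _)).2 (have := hproj; inferInstance),
      fun h ↦ ?_⟩
    have := hY.full
    have := hY.faithful
    have : Projective (cokernel (Y.map (S.map' 0 1))) :=
      projective_iff_hasProjectiveDimensionLT_one.2 h
    have hs := hse.splittingOfProjective
    obtain ⟨r, hr⟩ := Y.map_surjective hs.r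
    -- The retraction of `Y.map (S.map' 0 1)` lifts to `C` since `Y` is fully faithful.
    have := hs.f_r
    rw [← hr] at this
    exact ⟨⟨⟨r, Y.map_injective
      ((Y.map_comp _ _).trans (this.trans (Y.map_id _).symm))⟩⟩⟩
  | succ i ih =>
    have hse := shortExact_cokernel_desc _ _ _ (hY.exact_map (S.map' i (i + 1))
      (S.map' (i + 1) (i + 2)) (hS.comp_eq_zero i hi) fun W w hw ↦ ((hS W).2 i hi w).1 hw)
    have hiff := fun k ↦ hse.hasProjectiveDimensionLT_X₃_iff k (hproj _)
    obtain ⟨h₁, h₂⟩ := ih (by lia)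
    exact ⟨(hiff (i + 1)).2 h₁, fun h ↦ h₂ ((hiff i).1 h)⟩

end ProjectiveDimension

end HigherAbelian

namespace HigherAbelian

/-! ### Quasi-inverses along right exact sequences -/

section VonNeumannRegular

variable {C : Type u} [Category.{v} C]

lemma prop_of_arrow_mk_eq (P : MorphismProperty C) {X Y X' Y' : C} {f : X ⟶ Y} {g : X' ⟶ Y'}
    (h : Arrow.mk f = Arrow.mk g) (hf : P f) : P g := by
  have : P (Arrow.mk f).hom := hf
  rw [h] at this
  exact this

variable (C) in
/-- The morphisms `f` which have a quasi-inverse: some `g` with `f ≫ g ≫ f = f`. -/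
def hasQuasiInverse : MorphismProperty C := fun X Y f ↦ ∃ g : Y ⟶ X, f ≫ g ≫ f = f

/-- The idempotent `f ≫ g` splits through an object that serves as the image of `f`. -/
lemma isVonNeumannRegular_of_hasQuasiInverse [IsIdempotentComplete C]
    (h : ∀ {X Y : C} (f : X ⟶ Y), hasQuasiInverse C f) : IsVonNeumannRegular C := by
  intro X Y f
  obtain ⟨g, hg⟩ := h f
  obtain ⟨Z, i, e, hie, hei⟩ := IsIdempotentComplete.idempotents_split X (f ≫ g)
    (by simp [reassoc_of% hg])
  refine ⟨Z, e, i ≫ f, ⟨⟨⟨i, hie⟩⟩⟩, ⟨⟨⟨g ≫ e, ?_⟩⟩⟩, ?_⟩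
  · rw [Category.assoc, ← Category.assoc f, ← hei]
    simp [hie]
  · rw [← Category.assoc, hei, Category.assoc, hg]

variable [Preadditive C] {n : ℕ} {S : ComposableArrows C (n + 1)} (hS : IsRightExactSeq S)

include hS

lemma IsRightExactSeq.comp_eq_zero (i : ℕ) (hi : i < n) :
    S.map' i (i + 1) ≫ S.map' (i + 1) (i + 2) = 0 := by
  have := ((hS (S.obj' (i + 2))).2 i hi).apply_apply_eq_zero (𝟙 _)
  simpa only [Category.comp_id] using this

lemma IsRightExactSeq.epi_last : Epi (S.map' n (n + 1)) where
  left_cancellation {W} _ _ h := (hS W).1 h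

/-- If `s` is a quasi-inverse of `d`, then `𝟙 - s ≫ d` is killed by `d`, hence factors through the
next map; the factor is a quasi-inverse of that map. -/
lemma IsRightExactSeq.hasQuasiInverse_of_first (h : hasQuasiInverse C (S.map' 0 1))
    (i : ℕ) (hi : i ≤ n) : hasQuasiInverse C (S.map' i (i + 1)) := by
  induction i with
  | zero => exact h
  | succ i ih =>
    obtain ⟨s, hs⟩ := ih (by lia)
    obtain ⟨r, hr⟩ := ((hS (S.obj' (i + 1))).2 i hi (𝟙 _ - s ≫ S.map' i (i + 1))).1
      (by simp [hs])
    refine ⟨r, ?_⟩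
    dsimp only at hr
    rw [← Category.assoc, hr, Preadditive.sub_comp, Category.id_comp, Category.assoc,
      hS.comp_eq_zero i hi, comp_zero, sub_zero]

/-- A quasi-inverse of `d'` splits off its kernel `j`. The corestriction `d ≫ π` of `d` to this
kernel is epi by exactness, hence split, and its section provides a quasi-inverse of `d`. -/
lemma IsRightExactSeq.hasQuasiInverse_of_succ [IsIdempotentComplete C]
    (hepi : ∀ {X Y : C} (f : X ⟶ Y) [Epi f], IsSplitEpi f) (i : ℕ) (hi : i < n)
    (h : hasQuasiInverse C (S.map' (i + 1) (i + 2))) :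
    hasQuasiInverse C (S.map' i (i + 1)) := by
  have hd := hS.comp_eq_zero i hi
  have hex := fun (W : C) (g : S.obj' (i + 1) ⟶ W) (hg : S.map' i (i + 1) ≫ g = 0) ↦
    ((hS W).2 i hi g).1 hg
  generalize S.map' i (i + 1) = d at *
  generalize S.map' (i + 1) (i + 2) = d' at *
  obtain ⟨s, hs⟩ := h
  obtain ⟨Z, j, π, hjπ, hπj⟩ := IsIdempotentComplete.idempotents_split _ (𝟙 _ - d' ≫ s)
    (by simp [reassoc_of% hs])
  have hjd : j ≫ d' = 0 := by
    have : π ≫ j ≫ d' = 0 := by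
      rw [← Category.assoc, hπj]
      simp [hs]
    simpa [reassoc_of% hjπ] using j ≫= this
  have hdπ : d ≫ π ≫ j = d := by
    rw [hπj]
    simp [reassoc_of% hd]
  have : Epi (d ≫ π) := by
    refine Preadditive.epi_of_cancel_zero _ fun {W} g hg ↦ ?_
    obtain ⟨k, hk⟩ := hex W (π ≫ g) (by simpa using hg)
    dsimp only at hk
    have := j ≫= hk
    rw [reassoc_of% hjd, reassoc_of% hjπ, zero_comp] at this
    exact this.symm
  have := hepi (d ≫ π)
  have h : section_ (d ≫ π) ≫ d = j := calc
    _ = section_ (d ≫ π) ≫ d ≫ π ≫ j := by rw [hdπ]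
    _ = (section_ (d ≫ π) ≫ d ≫ π) ≫ j := by simp only [Category.assoc]
    _ = j := by rw [IsSplitEpi.id, Category.id_comp]
  exact ⟨π ≫ section_ (d ≫ π), by rw [Category.assoc, h, hdπ]⟩

lemma IsRightExactSeq.hasQuasiInverse_first [IsIdempotentComplete C]
    (hepi : ∀ {X Y : C} (f : X ⟶ Y) [Epi f], IsSplitEpi f) :
    hasQuasiInverse C (S.map' 0 1) := by
  -- Descending induction from the last map, with `i` the distance to it.
  suffices ∀ i k (hk : k + i = n), hasQuasiInverse C (S.map' k (k + 1)) from
    this n 0 (by lia)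
  intro i
  induction i with
  | zero =>
    rintro k rfl
    have := hS.epi_last
    have h : IsSplitEpi (S.map' k (k + 1)) := hepi _
    exact ⟨section_ _, by rw [IsSplitEpi.id]; exact Category.comp_id _⟩
  | succ i ih =>
    intro k hk
    exact hS.hasQuasiInverse_of_succ hepi k (by lia) (ih (k + 1) (by lia))

omit hS
namespace IsNAbelian

variable [IsIdempotentComplete C] (hC : IsNAbelian C n)
include hC

lemma isVonNeumannRegular_of_isSplitEpi
    (hepi : ∀ {X Y : C} (f : X ⟶ Y) [Epi f], IsSplitEpi f) : IsVonNeumannRegular C := by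
  refine isVonNeumannRegular_of_hasQuasiInverse fun f ↦ ?_
  obtain ⟨S, hS⟩ := hC.hasNCokernels f
  exact prop_of_arrow_mk_eq _ hS.first_eq (hS.exact.hasQuasiInverse_first hepi)

lemma exists_not_isSplitMono (hreg : ¬ IsVonNeumannRegular C) :
    ∃ S : ComposableArrows C (n + 1), IsLeftExactSeq S ∧ ¬ IsSplitMono (S.map' 0 1) := by
  by_contra! h
  refine hreg (hC.isVonNeumannRegular_of_isSplitEpi fun f _ ↦ ?_)
  obtain ⟨S, hS⟩ := hC.hasNKernels f
  have := h S hS.exact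
  obtain ⟨g, hg⟩ := prop_of_arrow_mk_eq _ hS.last_eq
    ((hC.isNCokernel_of_epi f S hS).exact.hasQuasiInverse_of_first
      ⟨retraction _, by rw [← Category.assoc, IsSplitMono.id]; exact Category.id_comp _⟩ n le_rfl)
  -- A quasi-inverse of an epi is a section.
  exact ⟨⟨⟨g, by rw [← cancel_epi f, hg, Category.comp_id]⟩⟩⟩

lemma exists_not_isSplitEpi (hreg : ¬ IsVonNeumannRegular C) :
    ∃ S : ComposableArrows C (n + 1), IsRightExactSeq S ∧ ¬ IsSplitEpi (S.map' n (n + 1)) := by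
  by_contra! h
  refine hreg (hC.isVonNeumannRegular_of_isSplitEpi fun f _ ↦ ?_)
  obtain ⟨S, hS⟩ := hC.hasNKernels f
  exact prop_of_arrow_mk_eq (fun _ _ f ↦ IsSplitEpi f) hS.last_eq
    (h S (hC.isNCokernel_of_epi f S hS).exact)

end IsNAbelian

end VonNeumannRegular

/-! ### Passage to the opposite category -/

section Opposite

variable {C : Type u} [Category.{v} C] [Preadditive C] {n : ℕ}

/-- The sequence in `Cᵒᵖ` obtained by reversing a sequence in `C`. -/
@[simps]
def opSeq (S : ComposableArrows C n) : ComposableArrows Cᵒᵖ n where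
  obj i := op (S.obj i.rev)
  map f := (S.map (homOfLE (Fin.rev_le_rev.2 (leOfHom f)))).op
  map_id i := congrArg Quiver.Hom.op (S.map_id i.rev)
  map_comp f g := congrArg Quiver.Hom.op (S.map_comp (homOfLE (Fin.rev_le_rev.2 (leOfHom g)))
    (homOfLE (Fin.rev_le_rev.2 (leOfHom f))))

variable {S : ComposableArrows C (n + 1)}

/-- Indices of the form `Fin.rev` are consecutive only propositionally, so exactness is restated for
arbitrary indices with consecutive values. -/
lemma IsRightExactSeq.exact_of_val_eq (hS : IsRightExactSeq S) (W : C) (a b c : Fin (n + 1 + 1))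
    (hab : a.val + 1 = b.val) (hbc : b.val + 1 = c.val) (f : a ⟶ b) (g : b ⟶ c) :
    Function.Exact (fun x : S.obj c ⟶ W => S.map g ≫ x)
      (fun x : S.obj b ⟶ W => S.map f ≫ x) := by
  obtain ⟨a, ha⟩ := a
  obtain ⟨b, hb⟩ := b
  obtain ⟨c, hc⟩ := c
  dsimp only at hab hbc
  subst hab hbc
  exact (hS W).2 a (by lia)

lemma IsRightExactSeq.opSeq (hS : IsRightExactSeq S) : IsLeftExactSeq (opSeq S) := by
  refine fun W ↦ ⟨fun x y h ↦ ?_, fun i hi y ↦ ?_⟩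
  · exact Quiver.Hom.unop_inj ((hS W.unop).1 (congrArg Quiver.Hom.unop h))
  · have h := hS.exact_of_val_eq W.unop (Fin.rev ⟨i + 2, by lia⟩) (Fin.rev ⟨i + 1, by lia⟩)
      (Fin.rev ⟨i, by lia⟩) (by simp; lia) (by simp; lia)
      (homOfLE (Fin.rev_le_rev.2 (by simp))) (homOfLE (Fin.rev_le_rev.2 (by simp))) y.unop
    refine ⟨fun hy ↦ ?_, ?_⟩
    · obtain ⟨x, hx⟩ := h.1 (congrArg Quiver.Hom.unop hy)
      exact ⟨x.op, congrArg Quiver.Hom.op hx⟩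
    · rintro ⟨x, hx⟩
      exact congrArg Quiver.Hom.op (h.2 ⟨x.unop, congrArg Quiver.Hom.unop hx⟩)

omit [Preadditive C] in
lemma opSeq_arrow_mk {m : ℕ} (S : ComposableArrows C m) (i j k l : ℕ) (hij : i ≤ j) (hj : j ≤ m)
    (hk : k + j = m) (hl : l + i = m) :
    Arrow.mk ((HigherAbelian.opSeq S).map' i j) = Arrow.mk (S.map' k l).op := by
  obtain rfl : k = m - j := by lia
  obtain rfl : l = m - i := by lia
  have hrev (i : ℕ) (hi : i ≤ m) : Fin.rev (⟨i, by lia⟩ : Fin (m + 1)) = ⟨m - i, by lia⟩ := by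
    ext; simp
  have key : ∀ (a b a' b' : Fin (m + 1)) (f : a ⟶ b) (f' : a' ⟶ b') (_ : a = a') (_ : b = b'),
      Arrow.mk (S.map f).op = Arrow.mk (S.map f').op := by
    rintro a b _ _ f f' rfl rfl
    rw [Subsingleton.elim f f']
  exact key _ _ _ _ _ _ (hrev j hj) (hrev i (by lia))

end Opposite

section Opposite

variable {C : Type u} [Category.{v} C] [Preadditive C] {n : ℕ} (hC : IsNAbelian C n)
include hC

lemma IsNAbelian.hasNKernels_op {X Y : Cᵒᵖ} (f : X ⟶ Y) :
    ∃ S : ComposableArrows Cᵒᵖ (n + 1), IsNKernel f S := by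
  obtain ⟨S, hS⟩ := hC.hasNCokernels f.unop
  refine ⟨opSeq S, (opSeq_arrow_mk S n (n + 1) 0 1 (by lia) le_rfl (by lia) (by lia)).trans ?_,
    hS.exact.opSeq⟩
  exact congrArg (fun a : Arrow C ↦ Arrow.mk a.hom.op) hS.first_eq

lemma IsNAbelian.exists_op_not_isSplitMono [IsIdempotentComplete C]
    (hreg : ¬ IsVonNeumannRegular C) :
    ∃ S : ComposableArrows Cᵒᵖ (n + 1), IsLeftExactSeq S ∧ ¬ IsSplitMono (S.map' 0 1) := by
  obtain ⟨S, hS, h⟩ := hC.exists_not_isSplitEpi hreg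
  refine ⟨opSeq S, hS.opSeq, fun hs ↦ h ?_⟩
  have : IsSplitMono (S.map' n (n + 1)).op :=
    prop_of_arrow_mk_eq (fun _ _ f ↦ IsSplitMono f)
      (opSeq_arrow_mk S 0 1 n (n + 1) (by lia) (by lia) (by lia) (by lia)) hs
  obtain ⟨⟨r, hr⟩⟩ := this.exists_splitMono
  exact ⟨⟨⟨r.unop, congrArg Quiver.Hom.unop hr⟩⟩⟩

end Opposite

end HigherAbelian

namespace HigherAbelian

/-! ### Finitely presented modules form an abelian category -/

section FinitelyPresented

open scoped ZeroObject

variable {C : Type u} [Category.{v} C] [Preadditive C]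

/-- `y : F(Y)` is a generator of the module `F` with relations generated by `f : X ⟶ Y`. -/
structure IsPresentedBy (F : Cᵒᵖ ⥤ AddCommGrpCat.{v}) {X Y : C} (f : X ⟶ Y)
    (y : F.obj (op Y)) : Prop where
  exists_map_eq : ∀ {W : C} (z : F.obj (op W)), ∃ g : W ⟶ Y, F.map g.op y = z
  map_op_eq_zero_iff : ∀ {W : C} (g : W ⟶ Y), F.map g.op y = 0 ↔ ∃ h, h ≫ f = g

lemma map_op_add (F : Cᵒᵖ ⥤ AddCommGrpCat.{v}) [F.Additive] {W Y : C} (g h : W ⟶ Y)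
    (y : F.obj (op Y)) : F.map (g + h).op y = F.map g.op y + F.map h.op y := by
  rw [op_add, F.map_add]
  rfl

omit [Preadditive C] in
lemma map_op_comp (F : Cᵒᵖ ⥤ AddCommGrpCat.{v}) {V W Y : C} (g : V ⟶ W) (h : W ⟶ Y)
    (y : F.obj (op Y)) : F.map (g ≫ h).op y = F.map g.op (F.map h.op y) := by
  rw [op_comp, F.map_comp]
  rfl

omit [Preadditive C] in
lemma app_map_op {F G : Cᵒᵖ ⥤ AddCommGrpCat.{v}} (α : F ⟶ G) {W Y : C} (g : W ⟶ Y)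
    (y : F.obj (op Y)) : α.app (op W) (F.map g.op y) = G.map g.op (α.app (op Y) y) :=
  ConcreteCategory.congr_hom (α.naturality g.op) y

/-- The morphism from a representable module corresponding to an element by the Yoneda lemma. -/
def yonedaHom (F : Cᵒᵖ ⥤ AddCommGrpCat.{v}) [F.Additive] {Y : C} (y : F.obj (op Y)) :
    preadditiveYoneda.obj Y ⟶ F where
  app W := AddCommGrpCat.ofHom (AddMonoidHom.mk' (fun g : W.unop ⟶ Y ↦ F.map g.op y)
    fun g h ↦ map_op_add F g h y)
  naturality V W g := by
    ext h
    exact map_op_comp F g.unop h y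

lemma isFinitelyPresented_iff (F : Cᵒᵖ ⥤ AddCommGrpCat.{v}) :
    IsFinitelyPresented C F ↔
      F.Additive ∧ ∃ (X Y : C) (f : X ⟶ Y) (y : F.obj (op Y)), IsPresentedBy F f y := by
  refine and_congr_right fun hF ↦ ⟨?_, ?_⟩
  · rintro ⟨X, Y, f, p, h⟩
    have hp {W : C} (g : W ⟶ Y) : F.map g.op (p.app (op Y) (𝟙 Y)) = p.app (op W) g := by
      refine (app_map_op p g _).symm.trans (congrArg (p.app (op W)) ?_)
      exact Category.comp_id g
    refine ⟨X, Y, f, p.app (op Y) (𝟙 Y), fun {W} z ↦ ?_, fun {W} g ↦ ?_⟩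
    · obtain ⟨g, hg⟩ := (h (op W)).2 z
      exact ⟨g, (hp g).trans hg⟩
    · rw [hp]
      exact (h (op W)).1 g
  · rintro ⟨X, Y, f, y, h⟩
    exact ⟨X, Y, f, yonedaHom F y, fun W ↦ ⟨fun g ↦ h.map_op_eq_zero_iff g, fun z ↦
      h.exists_map_eq z⟩⟩

omit [Preadditive C] in
lemma exact_app {S : ShortComplex (Cᵒᵖ ⥤ AddCommGrpCat.{v})} (hS : S.Exact)
    (W : Cᵒᵖ) : Function.Exact (S.f.app W) (S.g.app W) :=
  (ShortComplex.ab_exact_iff_function_exact _).1 (hS.map ((evaluation _ _).obj W))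

lemma additive_of_injective {F G : Cᵒᵖ ⥤ AddCommGrpCat.{v}} [G.Additive] (i : F ⟶ G)
    (hi : ∀ W, Function.Injective (i.app W)) : F.Additive where
  map_add {V W f g} := by
    ext x
    apply hi
    refine (app_map_op i (f + g).unop x).trans ?_
    rw [unop_add, map_op_add, ← app_map_op, ← app_map_op]
    exact (map_add (i.app W).hom _ _).symm

lemma additive_of_surjective {F G : Cᵒᵖ ⥤ AddCommGrpCat.{v}} [F.Additive] (p : F ⟶ G)
    (hp : ∀ W, Function.Surjective (p.app W)) : G.Additive where
  map_add {V W f g} := by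
    ext y
    obtain ⟨x, rfl⟩ := hp _ y
    refine (app_map_op p (f + g).unop x).symm.trans ?_
    rw [unop_add, map_op_add]
    refine (map_add (p.app W).hom _ _).trans ?_
    exact congrArg₂ (· + ·) (app_map_op p f.unop x) (app_map_op p g.unop x)

variable (C) in
/-- Every morphism `f` has a weak kernel: a morphism `k` such that `k ≫ f = 0` and every `g` with
`g ≫ f = 0` factors through `k`. -/
def HasWeakKernels : Prop := ∀ {X Y : C} (f : X ⟶ Y), ∃ (K : C) (k : K ⟶ X),
  ∀ {W : C} (g : W ⟶ X), g ≫ f = 0 ↔ ∃ h, h ≫ k = g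

/-- A weak pullback is a weak kernel of `(f, -g)` on the biproduct; only its first leg is kept. -/
lemma HasWeakKernels.exists_weakPullback [HasBinaryBiproducts C] (hC : HasWeakKernels C)
    {X Y Z : C} (f : X ⟶ Z) (g : Y ⟶ Z) : ∃ (P : C) (p : P ⟶ X),
      ∀ {W : C} (a : W ⟶ X), (∃ b, b ≫ g = a ≫ f) ↔ ∃ h, h ≫ p = a := by
  obtain ⟨P, k, hk⟩ := hC (biprod.desc f (-g))
  refine ⟨P, k ≫ biprod.fst, fun {W} a ↦ ⟨?_, ?_⟩⟩
  · rintro ⟨b, hb⟩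
    obtain ⟨h, hh⟩ := (hk (biprod.lift a b)).1 (by simp [hb])
    exact ⟨h, by rw [← Category.assoc, hh, biprod.lift_fst]⟩
  · rintro ⟨h, rfl⟩
    have := h ≫= (hk k).2 ⟨𝟙 _, Category.id_comp _⟩
    refine ⟨h ≫ k ≫ biprod.snd, Eq.symm ?_⟩
    rw [biprod.desc_eq] at this
    simpa [add_neg_eq_zero] using this

/-- With `a` lifting `α` to generators, a weak pullback `z` of `f'` along `a` generates the kernel,
and a weak pullback of `f` along `z` gives its relations. -/
lemma IsPresentedBy.kernel [HasBinaryBiproducts C] (hC : HasWeakKernels C)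
    {K F G : Cᵒᵖ ⥤ AddCommGrpCat.{v}} [F.Additive] [G.Additive] {i : K ⟶ F} {α : F ⟶ G}
    (hi : ∀ W, Function.Injective (i.app W)) (hex : ∀ W, Function.Exact (i.app W) (α.app W))
    {X Y X' Y' : C} {f : X ⟶ Y} {f' : X' ⟶ Y'} {y : F.obj (op Y)} {y' : G.obj (op Y')}
    (hF : IsPresentedBy F f y) (hG : IsPresentedBy G f' y') :
    ∃ (Z' Z : C) (r : Z' ⟶ Z) (k : K.obj (op Z)), IsPresentedBy K r k := by
  obtain ⟨a, ha⟩ := hG.exists_map_eq (α.app (op Y) y)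
  have hα {W : C} (g : W ⟶ Y) : α.app (op W) (F.map g.op y) = 0 ↔ ∃ b, b ≫ f' = g ≫ a := by
    rw [app_map_op, ← ha, ← map_op_comp, hG.map_op_eq_zero_iff]
  obtain ⟨Z, z, hz⟩ := hC.exists_weakPullback a f'
  obtain ⟨Z', r, hr⟩ := hC.exists_weakPullback z f
  obtain ⟨k, hk⟩ := (hex _ _).1 ((hα z).2 ((hz z).2 ⟨𝟙 _, Category.id_comp _⟩))
  refine ⟨Z', Z, r, k, fun {W} x ↦ ?_, fun {W} g ↦ ?_⟩
  · obtain ⟨g, hg⟩ := hF.exists_map_eq (i.app _ x)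
    obtain ⟨h, rfl⟩ := (hz g).1 ((hα g).1 (by rw [hg]; exact (hex _ _).2 ⟨x, rfl⟩))
    refine ⟨h, hi _ ?_⟩
    rw [app_map_op, hk, ← map_op_comp, hg]
  · rw [← hr, ← hF.map_op_eq_zero_iff, map_op_comp, ← hk, ← app_map_op]
    exact (map_eq_zero_iff (i.app (op W)).hom (hi _)).symm

/-- The generator of `G` still generates; to its relations `f'` are added the images `a` of the
generator of `F`. -/
lemma IsPresentedBy.cokernel [HasBinaryBiproducts C]
    {F G Q : Cᵒᵖ ⥤ AddCommGrpCat.{v}} [F.Additive] [G.Additive] {α : F ⟶ G} {p : G ⟶ Q}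
    (hp : ∀ W, Function.Surjective (p.app W)) (hex : ∀ W, Function.Exact (α.app W) (p.app W))
    {X Y X' Y' : C} {f : X ⟶ Y} {f' : X' ⟶ Y'} {y : F.obj (op Y)} {y' : G.obj (op Y')}
    (hF : IsPresentedBy F f y) (hG : IsPresentedBy G f' y') :
    ∃ (Z' Z : C) (r : Z' ⟶ Z) (k : Q.obj (op Z)), IsPresentedBy Q r k := by
  obtain ⟨a, ha⟩ := hG.exists_map_eq (α.app (op Y) y)
  have hα {W : C} (g : W ⟶ Y) : α.app (op W) (F.map g.op y) = G.map (g ≫ a).op y' := by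
    rw [app_map_op, ← ha, ← map_op_comp]
  refine ⟨X' ⊞ Y, Y', biprod.desc f' a, p.app _ y', fun {W} x ↦ ?_, fun {W} g ↦ ?_⟩
  · obtain ⟨z, rfl⟩ := hp _ x
    obtain ⟨g, rfl⟩ := hG.exists_map_eq z
    exact ⟨g, (app_map_op _ _ _).symm⟩
  · rw [← app_map_op]
    refine (hex _ _).trans ⟨?_, ?_⟩
    · rintro ⟨x, hx⟩
      obtain ⟨b, rfl⟩ := hF.exists_map_eq x
      rw [hα] at hx
      obtain ⟨c, hc⟩ := (hG.map_op_eq_zero_iff (g - b ≫ a)).1 (by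
        have := map_op_add G (g - b ≫ a) (b ≫ a) y'
        rwa [sub_add_cancel, hx, eq_comm, add_eq_right] at this)
      exact ⟨biprod.lift c b, by simp [hc]⟩
    · rintro ⟨h, rfl⟩
      refine ⟨F.map (h ≫ biprod.snd).op y, ?_⟩
      have h₀ : G.map (h ≫ biprod.fst ≫ f').op y' = 0 :=
        (hG.map_op_eq_zero_iff _).2 ⟨h ≫ biprod.fst, by simp⟩
      rw [hα, biprod.desc_eq, Preadditive.comp_add, map_op_add, h₀, zero_add, Category.assoc]

lemma additive_of_biprod {F G B : Cᵒᵖ ⥤ AddCommGrpCat.{v}} [F.Additive] [G.Additive]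
    {i : F ⟶ B} {j : G ⟶ B} {p : B ⟶ F} {q : B ⟶ G} (h : p ≫ i + q ≫ j = 𝟙 B) :
    B.Additive where
  map_add {V W f g} := by
    have key (f : V ⟶ W) : B.map f = p.app V ≫ F.map f ≫ i.app W + q.app V ≫ G.map f ≫ j.app W := by
      have := B.map f ≫= NatTrans.congr_app h W
      simpa using this.symm
    rw [key, key f, key g, F.map_add, G.map_add]
    simp only [Preadditive.add_comp, Preadditive.comp_add]
    abel

lemma IsPresentedBy.biprod [HasBinaryBiproducts C]
    {F G B : Cᵒᵖ ⥤ AddCommGrpCat.{v}} [F.Additive] [G.Additive] [B.Additive]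
    {i : F ⟶ B} {j : G ⟶ B} {p : B ⟶ F} {q : B ⟶ G} (hip : i ≫ p = 𝟙 F) (hiq : i ≫ q = 0)
    (hjp : j ≫ p = 0) (hjq : j ≫ q = 𝟙 G) (h : p ≫ i + q ≫ j = 𝟙 B)
    {X Y X' Y' : C} {f : X ⟶ Y} {f' : X' ⟶ Y'} {y : F.obj (op Y)} {y' : G.obj (op Y')}
    (hF : IsPresentedBy F f y) (hG : IsPresentedBy G f' y') :
    ∃ b : B.obj (op (Y ⊞ Y')), IsPresentedBy B (biprod.map f f') b := by
  have hip' {W : C} (x : F.obj (op W)) : p.app _ (i.app _ x) = x :=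
    ConcreteCategory.congr_hom (NatTrans.congr_app hip (op W)) x
  have hiq' {W : C} (x : F.obj (op W)) : q.app _ (i.app _ x) = 0 :=
    ConcreteCategory.congr_hom (NatTrans.congr_app hiq (op W)) x
  have hjp' {W : C} (x : G.obj (op W)) : p.app _ (j.app _ x) = 0 :=
    ConcreteCategory.congr_hom (NatTrans.congr_app hjp (op W)) x
  have hjq' {W : C} (x : G.obj (op W)) : q.app _ (j.app _ x) = x :=
    ConcreteCategory.congr_hom (NatTrans.congr_app hjq (op W)) x
  have h' {W : C} (x : B.obj (op W)) : i.app _ (p.app _ x) + j.app _ (q.app _ x) = x :=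
    ConcreteCategory.congr_hom (NatTrans.congr_app h (op W)) x
  let b := i.app _ (F.map (biprod.fst : Y ⊞ Y' ⟶ Y).op y) +
    j.app _ (G.map (biprod.snd : Y ⊞ Y' ⟶ Y').op y')
  have hb {W : C} (g : W ⟶ Y ⊞ Y') : B.map g.op b =
      i.app _ (F.map (g ≫ biprod.fst).op y) + j.app _ (G.map (g ≫ biprod.snd).op y') := by
    refine (map_add (B.map g.op).hom _ _).trans (congrArg₂ (· + ·) ?_ ?_)
    · exact (app_map_op i g _).symm.trans (congrArg _ (map_op_comp F g _ y).symm)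
    · exact (app_map_op j g _).symm.trans (congrArg _ (map_op_comp G g _ y').symm)
  have hzero {W : C} (x : F.obj (op W)) (x' : G.obj (op W)) :
      i.app _ x + j.app _ x' = 0 ↔ x = 0 ∧ x' = 0 := by
    refine ⟨fun hx ↦ ⟨?_, ?_⟩, ?_⟩
    · have := congrArg (p.app _) hx
      simpa [hip', hjp'] using this
    · have := congrArg (q.app _) hx
      simpa [hiq', hjq'] using this
    · rintro ⟨rfl, rfl⟩
      simp
  refine ⟨b, fun {W} x ↦ ?_, fun {W} g ↦ ?_⟩
  · obtain ⟨g, hg⟩ := hF.exists_map_eq (p.app _ x)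
    obtain ⟨g', hg'⟩ := hG.exists_map_eq (q.app _ x)
    refine ⟨biprod.lift g g', ?_⟩
    rw [hb, biprod.lift_fst, biprod.lift_snd, hg, hg', h']
  · rw [hb, hzero, hF.map_op_eq_zero_iff, hG.map_op_eq_zero_iff]
    refine ⟨?_, ?_⟩
    · rintro ⟨⟨a, ha⟩, ⟨a', ha'⟩⟩
      refine ⟨biprod.lift a a', ?_⟩
      ext <;> simp [ha, ha']
    · rintro ⟨a, rfl⟩
      exact ⟨⟨a ≫ biprod.fst, by simp⟩, ⟨a ≫ biprod.snd, by simp⟩⟩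

instance : (IsFinitelyPresented C).IsClosedUnderIsomorphisms where
  of_iso {F G} e hF := by
    rw [isFinitelyPresented_iff] at hF ⊢
    obtain ⟨_, X, Y, f, y, h⟩ := hF
    have he {W : Cᵒᵖ} (z : G.obj W) : e.hom.app W (e.inv.app W z) = z :=
      ConcreteCategory.congr_hom (NatTrans.congr_app e.inv_hom_id W) z
    have he' {W : Cᵒᵖ} (z : F.obj W) : e.inv.app W (e.hom.app W z) = z :=
      ConcreteCategory.congr_hom (NatTrans.congr_app e.hom_inv_id W) z
    refine ⟨Functor.additive_of_iso e, X, Y, f, e.hom.app _ y, fun {W} z ↦ ?_, fun {W} g ↦ ?_⟩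
    · obtain ⟨g, hg⟩ := h.exists_map_eq (e.inv.app _ z)
      exact ⟨g, by rw [← app_map_op, hg, he]⟩
    · rw [← app_map_op, ← h.map_op_eq_zero_iff]
      exact map_eq_zero_iff (e.hom.app (op W)).hom (Function.LeftInverse.injective he')

instance [HasBinaryBiproducts C] : (IsFinitelyPresented C).IsClosedUnderCokernels where
  cokernels_le := by
    rintro _ ⟨α, c, hc, hF, hG⟩
    rw [isFinitelyPresented_iff] at hF hG ⊢
    obtain ⟨_, _, _, _, _, hF⟩ := hF
    obtain ⟨_, _, _, _, _, hG⟩ := hG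
    have : Epi c.π := Cofork.IsColimit.epi hc
    have hp (W : Cᵒᵖ) : Function.Surjective (c.π.app W) :=
      (AddCommGrpCat.epi_iff_surjective _).1 inferInstance
    have hex := exact_app (ShortComplex.exact_of_g_is_cokernel (.mk α c.π c.condition)
      (IsColimit.ofIsoColimit hc (Cofork.isoCoforkOfπ c)))
    exact ⟨additive_of_surjective c.π hp, hF.cokernel hp hex hG⟩

lemma HasWeakKernels.isClosedUnderKernels [HasBinaryBiproducts C] (hC : HasWeakKernels C) :
    (IsFinitelyPresented C).IsClosedUnderKernels where
  kernels_le := by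
    rintro _ ⟨α, c, hc, hF, hG⟩
    rw [isFinitelyPresented_iff] at hF hG ⊢
    obtain ⟨_, _, _, _, _, hF⟩ := hF
    obtain ⟨_, _, _, _, _, hG⟩ := hG
    have : Mono c.ι := Fork.IsLimit.mono hc
    have hi (W : Cᵒᵖ) : Function.Injective (c.ι.app W) :=
      (AddCommGrpCat.mono_iff_injective _).1 inferInstance
    have hex := exact_app (ShortComplex.exact_of_f_is_kernel (.mk c.ι α c.condition)
      (IsLimit.ofIsoLimit hc (Fork.isoForkOfι c)))
    exact ⟨additive_of_injective c.ι hi, hF.kernel hC hi hex hG⟩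

lemma isFinitelyPresented_yoneda [HasZeroObject C] (X : C) :
    IsFinitelyPresented C (preadditiveYoneda.obj X) := by
  refine (isFinitelyPresented_iff _).2 ⟨inferInstance, 0, X, 0, 𝟙 X, fun {W} z ↦ ?_,
    fun {W} g ↦ ?_⟩
  · exact ⟨z, Category.comp_id z⟩
  · have : (preadditiveYoneda.obj X).map g.op (𝟙 X) = g := Category.comp_id g
    rw [this]
    exact ⟨fun hg ↦ ⟨0, by rw [hg]; exact zero_comp⟩, fun ⟨h, hh⟩ ↦ hh.symm.trans comp_zero⟩

instance [HasZeroObject C] : (IsFinitelyPresented C).ContainsZero where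
  exists_zero := ⟨preadditiveYoneda.obj 0, by
    rw [Functor.isZero_iff]
    intro W
    have : Subsingleton (W.unop ⟶ (0 : C)) := ⟨fun f g ↦ (isZero_zero C).eq_of_tgt f g⟩
    exact AddCommGrpCat.isZero_of_subsingleton (AddCommGrpCat.of (W.unop ⟶ (0 : C))),
    isFinitelyPresented_yoneda 0⟩

lemma isFinitelyPresented_biprod [HasBinaryBiproducts C] {F G : Cᵒᵖ ⥤ AddCommGrpCat.{v}}
    (hF : IsFinitelyPresented C F) (hG : IsFinitelyPresented C G) :
    IsFinitelyPresented C (F ⊞ G) := by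
  rw [isFinitelyPresented_iff] at hF hG ⊢
  obtain ⟨_, _, _, _, _, hF⟩ := hF
  obtain ⟨_, _, _, _, _, hG⟩ := hG
  have hadd : (F ⊞ G).Additive := additive_of_biprod biprod.total
  obtain ⟨b, hb⟩ := hF.biprod biprod.inl_fst biprod.inl_snd biprod.inr_fst biprod.inr_snd
    biprod.total hG
  exact ⟨hadd, _, _, _, b, hb⟩

instance [HasBinaryBiproducts C] [HasZeroObject C] :
    (IsFinitelyPresented C).IsClosedUnderFiniteProducts := by
  have : (IsFinitelyPresented C).IsClosedUnderBinaryProducts :=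
    { limitsOfShape_le := by
        rintro X ⟨p⟩
        exact (IsFinitelyPresented C).prop_of_iso
          (IsLimit.conePointsIsoOfNatIso p.isLimit (BinaryBiproduct.isLimit _ _)
            (diagramIsoPair p.diag)).symm
          (isFinitelyPresented_biprod (p.prop_diag_obj _) (p.prop_diag_obj _)) }
  exact .mk'

lemma HasWeakKernels.nonempty_abelian [HasBinaryBiproducts C] [HasZeroObject C]
    (hC : HasWeakKernels C) : Nonempty (Abelian (FPMod C)) := by
  have := hC.isClosedUnderKernels
  exact ⟨inferInstance⟩

variable (C) in
/-- The Yoneda embedding of `C` into the category of finitely presented modules. -/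
abbrev fpYoneda [HasZeroObject C] : C ⥤ FPMod C :=
  (IsFinitelyPresented C).lift preadditiveYoneda isFinitelyPresented_yoneda

/-- Closure under cokernels makes an epi of `FPMod C` an epi of functors, hence componentwise
surjective. -/
lemma surjective_of_epi [HasBinaryBiproducts C] [HasZeroObject C] {F G : FPMod C} (p : F ⟶ G)
    [Epi p] (W : Cᵒᵖ) : Function.Surjective (p.hom.app W) := by
  have := (IsFinitelyPresented C).preservesEpimorphisms_ι_of_isNormalMonoCategory
  have : Epi p.hom := inferInstanceAs (Epi ((IsFinitelyPresented C).ι.map p))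
  exact (AddCommGrpCat.epi_iff_surjective _).1 inferInstance

/-- An arbitrary `Abelian` instance brings its own zero morphisms; these are unique, so they agree
with the componentwise ones. -/
lemma hom_eq_zero_iff [I : HasZeroMorphisms (FPMod C)] {F G : FPMod C} (f : F ⟶ G) :
    f.hom = 0 ↔ f = 0 := by
  obtain rfl : I = Preadditive.preadditiveHasZeroMorphisms := Subsingleton.elim _ _
  exact ⟨fun h ↦ InducedCategory.Hom.ext h, fun h ↦ by rw [h]; rfl⟩

lemma isProjectivePresentation_fpYoneda [HasBinaryBiproducts C] [HasZeroObject C]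
    [Abelian (FPMod C)] : IsProjectivePresentation (fpYoneda C) where
  full := inferInstance
  faithful := inferInstance
  map_zero X X' := by
    refine (hom_eq_zero_iff (I := _) _).1 ?_
    ext W g
    exact comp_zero
  projective X := by
    refine ⟨fun {F G} f p _ ↦ ?_⟩
    have := F.property.1
    obtain ⟨z, hz⟩ := surjective_of_epi p (op X) (f.hom.app (op X) (𝟙 X))
    refine ⟨ObjectProperty.homMk (yonedaHom F.obj z), ?_⟩
    ext W g
    refine (app_map_op p.hom (W := W.unop) (Y := X) g z).trans ?_
    rw [hz]
    refine (app_map_op f.hom (W := W.unop) (Y := X) g (𝟙 X)).symm.trans ?_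
    exact congrArg (f.hom.app W) (Category.comp_id (X := W.unop) (Y := X) g)
  presentation F := by
    obtain ⟨_, X, Y, f, p, h⟩ := F.property
    refine ⟨X, Y, f, ObjectProperty.homMk p, ?_, ?_, fun W w hw ↦ ?_⟩
    · have (W : Cᵒᵖ) : Epi (p.app W) := (AddCommGrpCat.epi_iff_surjective _).2 (h W).2
      have : Epi p := NatTrans.epi_of_epi_app p
      exact (IsFinitelyPresented C).ι.epi_of_epi_map this
    · refine (hom_eq_zero_iff (I := _) _).1 ?_
      ext W g
      exact (h W).1.apply_apply_eq_zero g
    · replace hw := (hom_eq_zero_iff (I := _) _).2 hw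
      refine ((h (op W)).1 w).1 ?_
      have := ConcreteCategory.congr_hom (NatTrans.congr_app hw (op W)) (𝟙 W)
      refine Eq.trans ?_ this
      exact congrArg (p.app (op W)) (Category.id_comp w).symm

end FinitelyPresented

end HigherAbelian

namespace HigherAbelian

/-! ### Global dimension -/

section GlobalDimension

variable {C : Type u} [Category.{v} C] [Preadditive C] {n : ℕ}

lemma hasWeakKernels_of_hasNKernels (hn : 1 ≤ n)
    (hker : ∀ {X Y : C} (f : X ⟶ Y), ∃ S : ComposableArrows C (n + 1), IsNKernel f S) :
    HasWeakKernels C := by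
  intro X Y f
  obtain ⟨S, hS⟩ := hker f
  let P : MorphismProperty C := fun X Y f ↦ ∃ (K : C) (k : K ⟶ X),
    ∀ {W : C} (g : W ⟶ X), g ≫ f = 0 ↔ ∃ h, h ≫ k = g
  obtain ⟨m, rfl⟩ := Nat.exists_eq_add_of_le' hn
  -- Since `n = m + 1`, a map precedes `f` in its `n`-kernel, and it is a weak kernel.
  exact prop_of_arrow_mk_eq P hS.last_eq
    ⟨S.obj' m, S.map' m (m + 1), fun {W} g ↦ (hS.exact W).2 m (by lia) g⟩

lemma globalDimension_eq_of_isProjectivePresentation {A : Type*} [Category* A] [Abelian A]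
    {Y : C ⥤ A} (hY : IsProjectivePresentation Y)
    (hker : ∀ {X Y : C} (f : X ⟶ Y), ∃ S : ComposableArrows C (n + 1), IsNKernel f S)
    (hsplit : ∃ S : ComposableArrows C (n + 1), IsLeftExactSeq S ∧ ¬ IsSplitMono (S.map' 0 1)) :
    globalDimension A = ((n + 1 : ℕ) : WithBot ℕ∞) := by
  refine le_antisymm (iSup_le fun F ↦ ?_) ?_
  · obtain ⟨X, X', f, ⟨e⟩⟩ := hY.exists_iso_cokernel F
    obtain ⟨S, hS⟩ := hker f
    have := prop_of_arrow_mk_eq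
      (fun _ _ f ↦ HasProjectiveDimensionLT (cokernel (Y.map f)) (n + 2)) hS.last_eq
      (hS.exact.hasProjectiveDimensionLT hY n le_rfl).1
    rw [← projectiveDimension_eq_of_iso e, projectiveDimension_le_iff]
    exact this
  · obtain ⟨S, hS, h⟩ := hsplit
    -- The last cokernel attains the bound: dimension below `n + 1` would split the first map.
    refine le_trans ?_ (le_iSup _ (cokernel (Y.map (S.map' n (n + 1)))))
    rw [projectiveDimension_ge_iff]
    exact fun h' ↦ h ((hS.hasProjectiveDimensionLT hY n le_rfl).2 h')

lemma nonempty_abelian_and_globalDimension_eq [HasBinaryBiproducts C] [HasZeroObject C]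
    (hn : 1 ≤ n)
    (hker : ∀ {X Y : C} (f : X ⟶ Y), ∃ S : ComposableArrows C (n + 1), IsNKernel f S)
    (hsplit : ∃ S : ComposableArrows C (n + 1), IsLeftExactSeq S ∧ ¬ IsSplitMono (S.map' 0 1)) :
    Nonempty (Abelian (FPMod C)) ∧ ∀ [Abelian (FPMod C)],
      globalDimension (FPMod C) = ((n + 1 : ℕ) : WithBot ℕ∞) :=
  ⟨HasWeakKernels.nonempty_abelian (hasWeakKernels_of_hasNKernels hn hker),
    globalDimension_eq_of_isProjectivePresentation isProjectivePresentation_fpYoneda hker hsplit⟩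

end GlobalDimension

end HigherAbelian

theorem corollary1 (C : Type u) [Category.{v} C] [Preadditive C] [HasFiniteBiproducts C]
    [IsIdempotentComplete C] (n : ℕ) (hn : 1 ≤ n) (hC : HigherAbelian.IsNAbelian C n)
    (hreg : ¬ HigherAbelian.IsVonNeumannRegular C) :
    (Nonempty (Abelian (HigherAbelian.FPMod C)) ∧
      ∀ [Abelian (HigherAbelian.FPMod C)],
        HigherAbelian.globalDimension (HigherAbelian.FPMod C) = ((n + 1 : ℕ) : WithBot ℕ∞)) ∧
    (Nonempty (Abelian (HigherAbelian.FPMod Cᵒᵖ)) ∧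
      ∀ [Abelian (HigherAbelian.FPMod Cᵒᵖ)],
        HigherAbelian.globalDimension (HigherAbelian.FPMod Cᵒᵖ) =
          ((n + 1 : ℕ) : WithBot ℕ∞)) := by
  have := hasBinaryBiproducts_of_finite_biproducts C
  have : HasBinaryBiproducts Cᵒᵖ := .of_hasBinaryProducts
  exact ⟨HigherAbelian.nonempty_abelian_and_globalDimension_eq hn hC.hasNKernels
      (hC.exists_not_isSplitMono hreg),
    HigherAbelian.nonempty_abelian_and_globalDimension_eq hn hC.hasNKernels_op
      (hC.exists_op_not_isSplitMono hreg)⟩
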